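/- Let $E: y^2+a_1xy+a_3y=x^3+a_2x^2+a_4x+a_6$ be an elliptic curve with real coefficients (in particular, any Weierstrass model of an elliptic curve over $\mathbb{Q}$), and let $b_2=a_1^2+4a_2$, $b_4=2a_4+a_1a_3$, $b_6=a_3^2+4a_6$, so that $E$ takes the form $Y^2=4x^3+b_2x^2+2b_4x+b_6$ with $Y=2y+a_1x+a_3$. Then $E$ has a period lattice, that is, a lattice $\Lambda\subset\mathbb{C}$ whose Weierstrass function $\wp=\wp_\Lambda$ satisfies that $z\mapsto(x,Y)=(\wp(z)-b_2/12,\ \wp'(z))$ maps $\mathbb{C}\setminus\Lambda$ to the curve $Y^2=4x^3+b_2x^2+2b_4x+b_6$ (so that $dx/Y$ pulls back to $dz$). Let $\Omega$ be the covolume of this period lattice, i.e. the area of its fundamental parallelogram, and let $D=|\Delta|$ be the absolute value of the discriminant $\Delta$ of the given equation of $E$. Then $$\frac1\Omega\ \ge\ \frac{D^{1/6}}{14.045}.$$ -/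

import Mathlib

/-- `L` is a pair of basic periods of the elliptic curve
`y ^ 2 = 4 * x ^ 3 + b₂ * x ^ 2 + 2 * b₄ * x + b₆` attached to the Weierstrass equation `W` (the
`y` here is `2 * y + a₁ * x + a₃` in the coordinates of `W`): the map `z ↦ (℘ z - b₂ / 12, ℘' z)`,
with `℘` the Weierstrass function of the lattice `L.lattice = ℤ ω₁ + ℤ ω₂`, sends `ℂ \ L.lattice`
to this curve. As the derivative of `℘` is `℘'`, it pulls the invariant differential `dx / y`
back to `dz`, so that `L.lattice` is the period lattice of the curve. -/
def WeierstrassCurve.IsPeriodPair (W : WeierstrassCurve ℂ) (L : PeriodPair) : Prop :=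
  ∀ z : ℂ, z ∉ L.lattice →
    L.derivWeierstrassP z ^ 2 =
      4 * (L.weierstrassP z - W.b₂ / 12) ^ 3 + W.b₂ * (L.weierstrassP z - W.b₂ / 12) ^ 2 +
        2 * W.b₄ * (L.weierstrassP z - W.b₂ / 12) + W.b₆

/-- The area of the fundamental parallelogram of the lattice `ℤ ω₁ + ℤ ω₂`. -/
noncomputable def PeriodPair.parallelogramArea (L : PeriodPair) : ℝ :=
  ZLattice.covolume L.lattice

open UpperHalfPlane ModularForm EisensteinSeries MatrixGroups Filter Topology
open scoped Real

/-! Comparing differential equations identifies the period lattices of `W` with the lattices having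
`g₂ = c₄/12` and `g₃ = c₆/216`. For a basis `(ω₁, ω₁τ)`, this gives `|Δ_W| = |2π/ω₁|¹² |Δ(τ)|`,
while the area is `|ω₁|² Im τ`. So `|Δ_W| Ω⁶ = (2π)¹² |Δ(τ)| (Im τ)⁶`, an `SL(2, ℤ)`-invariant
quantity (`norm_discriminant_mul_im_pow_smul`), and `τ` may be taken with `Im τ ≥ √3/2`. There `Δ =
η²⁴`, and the product for `η` bounds `Im τ |η|⁴` by a function of `Im τ` alone that decreases on
`[√3/2, ∞)`; its value at `√3/2` gives 14.045.

Existence of a lattice (`exists_E₄_E₆_eq`): the weight 12 form `c₆² E₄³ - c₄³ E₆²` does not vanish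
at the cusp, so it has a zero in the upper half plane, and rescaling the lattice at that zero gives
the right invariants. -/

/-! ### Period lattices and the invariants of the curve -/

/-- The Weierstrass function of a lattice takes infinitely many values, so an affine relation
satisfied by it off the lattice is trivial. -/
theorem PeriodPair.eq_zero_of_weierstrassP_affine (L : PeriodPair) {a b : ℂ}
    (h : ∀ z ∉ L.lattice, a * L.weierstrassP z + b = 0) : a = 0 ∧ b = 0 := by
  have ha : a = 0 := by
    by_contra ha
    have hev : L.weierstrassP =ᶠ[nhdsWithin 0 {0}ᶜ] fun _ ↦ -b / a := by
      filter_upwards [self_mem_nhdsWithin, mem_nhdsWithin_of_mem_nhds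
        (L.compl_lattice_sdiff_singleton_mem_nhds 0)] with z hz hz'
      have := h z (by simp_all)
      field_simp
      linear_combination this
    -- A pole at `0` is incompatible with a constant, whose order is `0` or `⊤`.
    have h1 := L.order_weierstrassP 0 (zero_mem _)
    rw [meromorphicOrderAt_congr hev, meromorphicOrderAt_const] at h1
    split_ifs at h1
    · exact absurd h1 (by decide)
    · exact absurd h1 (by decide)
  subst ha
  simpa using h _ L.ω₁_div_two_notMem_lattice

/-- The shift by `b₂/12` removes the quadratic term of the cubic; the other coefficients can be
compared because `℘` is not constant. -/
theorem WeierstrassCurve.isPeriodPair_iff (W : WeierstrassCurve ℂ) (L : PeriodPair) :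
    W.IsPeriodPair L ↔ L.g₂ = W.c₄ / 12 ∧ L.g₃ = W.c₆ / 216 := by
  constructor
  · intro h
    have := L.eq_zero_of_weierstrassP_affine (a := W.c₄ / 12 - L.g₂) (b := W.c₆ / 216 - L.g₃) ?_
    · exact ⟨(sub_eq_zero.mp this.1).symm, (sub_eq_zero.mp this.2).symm⟩
    intro z hz
    have h1 := h z hz
    rw [L.derivWeierstrassP_sq z hz] at h1
    simp only [WeierstrassCurve.c₄, WeierstrassCurve.c₆]
    linear_combination h1
  · rintro ⟨h2, h3⟩ z hz
    rw [L.derivWeierstrassP_sq z hz, h2, h3]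
    simp only [WeierstrassCurve.c₄, WeierstrassCurve.c₆]
    ring

namespace PeriodPair

theorem g₂_cube_sub_of_isPeriodPair {W : WeierstrassCurve ℂ} {L : PeriodPair}
    (h : W.IsPeriodPair L) : W.Δ = L.g₂ ^ 3 - 27 * L.g₃ ^ 2 := by
  obtain ⟨h2, h3⟩ := (W.isPeriodPair_iff L).mp h
  rw [h2, h3]
  linear_combination (1 / 1728 : ℂ) * W.c_relation

/-! ### Lattice bases, Eisenstein series and area -/

/-- The period pair with the two periods exchanged. -/
def swap (L : PeriodPair) : PeriodPair where
  ω₁ := L.ω₂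
  ω₂ := L.ω₁
  indep := LinearIndependent.pair_symm_iff.mp L.indep

theorem swap_lattice (L : PeriodPair) : L.swap.lattice = L.lattice := by
  simp only [lattice, swap, Set.pair_comm]

theorem G_congr {L L' : PeriodPair} (h : L.lattice = L'.lattice) (n : ℕ) : L.G n = L'.G n :=
  congrArg (fun M : Submodule ℤ ℂ ↦ ∑' l : M, ((l : ℂ) ^ n)⁻¹) h

theorem ω₁_ne_zero (L : PeriodPair) : L.ω₁ ≠ 0 := by
  simpa using L.indep.ne_zero 0

theorem im_div_ne_zero (L : PeriodPair) : (L.ω₂ / L.ω₁).im ≠ 0 := by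
  intro h
  have h1 := L.ω₁_ne_zero
  have h2 : L.ω₂ / L.ω₁ = ((L.ω₂ / L.ω₁).re : ℂ) := by
    apply Complex.ext <;> simp [h]
  have := LinearIndependent.pair_iff.mp L.indep (L.ω₂ / L.ω₁).re (-1) (by
    simp only [Complex.real_smul]
    rw [← h2]
    field_simp
    push_cast
    ring)
  simpa using this.2

/-- Every lattice has a positively oriented pair of basic periods. -/
theorem exists_lattice_eq_im_pos (L : PeriodPair) :
    ∃ L' : PeriodPair, L'.lattice = L.lattice ∧ 0 < (L'.ω₂ / L'.ω₁).im := by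
  rcases lt_or_gt_of_ne L.im_div_ne_zero with h | h
  · refine ⟨L.swap, L.swap_lattice, ?_⟩
    have : L.swap.ω₂ / L.swap.ω₁ = (L.ω₂ / L.ω₁)⁻¹ := by simp [swap]
    rw [this, Complex.inv_im]
    refine div_pos (by linarith) (Complex.normSq_pos.mpr ?_)
    intro h0
    simp [h0] at h
  · exact ⟨L, rfl, h⟩

/-- The period pair `(ω, ω τ)`. -/
def ofUpperHalfPlane (ω : ℂ) (hω : ω ≠ 0) (τ : ℍ) : PeriodPair where
  ω₁ := ω
  ω₂ := ω * τ
  indep := by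
    refine LinearIndependent.pair_iff.mpr fun s t h ↦ ?_
    have h1 : (s : ℂ) + t * τ = 0 := by
      simp only [Complex.real_smul] at h
      refine mul_left_cancel₀ hω ?_
      linear_combination h
    have h2 : t = 0 := by
      have := congrArg Complex.im h1
      simpa [τ.im_ne_zero] using this
    subst h2
    simpa using h1

theorem G_eq_tsum (L : PeriodPair) (n : ℕ) :
    L.G n = ∑' x : ℤ × ℤ, ((x.1 * L.ω₁ + x.2 * L.ω₂) ^ n)⁻¹ := by
  rw [G, ← L.latticeEquivProd.symm.toEquiv.tsum_eq]
  exact tsum_congr fun x ↦ by rw [← L.latticeEquiv_symm_apply]; rfl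

theorem G_eq_E (L : PeriodPair) (τ : ℍ) (h : L.ω₂ = L.ω₁ * τ) {k : ℕ} (hk : 3 ≤ k) :
    L.G k = 2 * riemannZeta k / L.ω₁ ^ k * E hk τ := by
  have hE : E hk τ = (1 / 2 : ℂ) * eisensteinSeries (N := 1) 0 k τ := rfl
  have hs := tsum_eisSummand_eq_riemannZeta_mul_eisensteinSeries hk τ
  have h1 : L.G k = (L.ω₁ ^ k)⁻¹ * ∑' v : Fin 2 → ℤ, eisSummand k v τ := by
    -- The coordinates are swapped because `eisSummand` uses `v 0 * τ + v 1`.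
    rw [G_eq_tsum, ← tsum_mul_left, ← ((finTwoArrowEquiv ℤ).trans (Equiv.prodComm ℤ ℤ)).tsum_eq]
    refine tsum_congr fun v ↦ ?_
    simp only [Equiv.trans_apply, finTwoArrowEquiv_apply, Equiv.prodComm_apply, Prod.swap,
      eisSummand, zpow_neg, zpow_natCast, h, ← mul_inv, ← mul_pow]
    congr 2
    simp only [Equiv.toFun_as_coe, piFinTwoEquiv_apply]
    ring
  rw [h1, hs, hE]
  ring

end PeriodPair

theorem riemannZeta_six : riemannZeta 6 = π ^ 6 / 945 := by
  have := riemannZeta_two_mul_nat (k := 3) (by norm_num)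
  have hb : bernoulli 6 = 1 / 42 := by decide +kernel
  norm_num [hb, Nat.factorial] at this
  rw [this]
  ring

namespace PeriodPair

theorem g₂_eq_E₄ (L : PeriodPair) (τ : ℍ) (h : L.ω₂ = L.ω₁ * τ) :
    L.g₂ = 4 / 3 * (π / L.ω₁) ^ 4 * E₄ τ := by
  have := L.G_eq_E τ h (k := 4) (by norm_num)
  rw [g₂, this]
  push_cast
  rw [riemannZeta_four]
  ring

theorem g₃_eq_E₆ (L : PeriodPair) (τ : ℍ) (h : L.ω₂ = L.ω₁ * τ) :
    L.g₃ = 8 / 27 * (π / L.ω₁) ^ 6 * E₆ τ := by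
  have := L.G_eq_E τ h (k := 6) (by norm_num)
  rw [g₃, this]
  push_cast
  rw [riemannZeta_six]
  ring

theorem g₂_cube_sub_eq_discriminant (L : PeriodPair) (τ : ℍ) (h : L.ω₂ = L.ω₁ * τ) :
    L.g₂ ^ 3 - 27 * L.g₃ ^ 2 = (2 * π / L.ω₁) ^ 12 * discriminant τ := by
  rw [L.g₂_eq_E₄ τ h, L.g₃_eq_E₆ τ h, discriminant_eq_E₄_cube_sub_E₆_sq]
  ring

theorem parallelogramArea_eq (L : PeriodPair) :
    L.parallelogramArea = ‖L.ω₁‖ ^ 2 * |(L.ω₂ / L.ω₁).im| := by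
  have h1 := L.ω₁_ne_zero
  have hc := ZLattice.covolume_eq_det_mul_measureReal L.lattice MeasureTheory.volume L.latticeBasis
    Complex.basisOneI
  have hv : MeasureTheory.volume.real (ZSpan.fundamentalDomain Complex.basisOneI) = 1 := by
    rw [← Complex.toBasis_orthonormalBasisOneI, MeasureTheory.measureReal_def,
      MeasureTheory.measure_congr (ZSpan.fundamentalDomain_ae_parallelepiped _ _),
      OrthonormalBasis.coe_toBasis, OrthonormalBasis.volume_parallelepiped]
    simp
  have hn : ‖L.ω₁‖ ^ 2 = Complex.normSq L.ω₁ := (Complex.normSq_eq_norm_sq _).symm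
  have hp : 0 ≤ Complex.normSq L.ω₁ := Complex.normSq_nonneg _
  refine hc.trans ?_
  rw [hv, mul_one, hn, ← abs_of_nonneg hp, ← abs_mul, Module.Basis.det_apply,
    Matrix.det_fin_two]
  congr 1
  have h0 : Complex.normSq L.ω₁ ≠ 0 := by simpa using h1
  simp [Module.Basis.toMatrix_apply, Complex.div_im]
  field_simp

theorem parallelogramArea_congr {L L' : PeriodPair} (h : L.lattice = L'.lattice) :
    L.parallelogramArea = L'.parallelogramArea := by
  simp only [parallelogramArea, h]

end PeriodPair

/-! ### Upper bound for the eta function -/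

/-- Among the `q` of fixed norm `r ≤ 1/10`, the product `|1 - q| |1 - q²|` is largest at `q = -r`. -/
theorem norm_one_sub_mul_norm_one_sub_sq_le {q : ℂ} (hq : ‖q‖ ≤ 1 / 10) :
    ‖1 - q‖ * ‖1 - q ^ 2‖ ≤ (1 + ‖q‖) ^ 2 * (1 - ‖q‖) := by
  set r := ‖q‖
  have hr0 : 0 ≤ r := norm_nonneg q
  have hr2 : r ^ 2 = q.re ^ 2 + q.im ^ 2 := by
    rw [← Complex.normSq_eq_norm_sq, Complex.normSq_apply]; ring
  have hre : |q.re| ≤ r := Complex.abs_re_le_norm q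
  obtain ⟨h1, h2⟩ := abs_le.mp hre
  have e1 : ‖1 - q‖ ^ 2 = 1 + r ^ 2 - 2 * q.re := by
    rw [← Complex.normSq_eq_norm_sq, Complex.normSq_apply, hr2]; simp; ring
  have e2 : ‖1 + q‖ ^ 2 = 1 + r ^ 2 + 2 * q.re := by
    rw [← Complex.normSq_eq_norm_sq, Complex.normSq_apply, hr2]; simp; ring
  have e3 : ‖1 - q ^ 2‖ = ‖1 - q‖ * ‖1 + q‖ := by rw [← norm_mul]; congr 1; ring
  refine le_of_sq_le_sq ?_ (mul_nonneg (by positivity) (by linarith))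
  have e4 : (‖1 - q‖ * ‖1 - q ^ 2‖) ^ 2 =
      (1 + r ^ 2 - 2 * q.re) ^ 2 * (1 + r ^ 2 + 2 * q.re) := by
    rw [e3, ← e1, ← e2]; ring
  rw [e4]
  -- The difference vanishes at `q = -r`, hence the factor `r + q.re`.
  have e5 : ((1 + r) ^ 2 * (1 - r)) ^ 2 - (1 + r ^ 2 - 2 * q.re) ^ 2 * (1 + r ^ 2 + 2 * q.re) =
      2 * (r + q.re) * ((1 + r ^ 2) ^ 2 - 2 * (1 + r ^ 2) * (r - q.re)
        - 4 * (r ^ 2 - r * q.re + q.re ^ 2)) := by ring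
  have e6 : 0 ≤ (1 + r ^ 2) ^ 2 - 2 * (1 + r ^ 2) * (r - q.re)
        - 4 * (r ^ 2 - r * q.re + q.re ^ 2) := by
    have h3 : (1 + r ^ 2) * (r - q.re) ≤ 101 / 100 * (1 / 5) := by
      gcongr
      · nlinarith
      · linarith
    have h4 : r * r ≤ 1 / 10 * (1 / 10) := mul_self_le_mul_self hr0 hq
    have h5 : q.re ^ 2 ≤ r * r := by linarith [sq_nonneg q.im]
    have h6 : -(r * r) ≤ r * q.re := by linarith [mul_nonneg hr0 (by linarith : 0 ≤ r + q.re)]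
    have h7 : 1 ≤ (1 + r ^ 2) ^ 2 := one_le_pow₀ (by linarith [sq_nonneg r])
    linarith
  have := mul_nonneg (mul_nonneg zero_le_two (by linarith : 0 ≤ r + q.re)) e6
  linarith

/-- The first two factors are bounded jointly; each later one by `|1 - qᵏ| ≤ exp |q|ᵏ`, with a
geometric sum in the exponent. -/
theorem norm_tprod_one_sub_pow_le {q : ℂ} (hq : ‖q‖ ≤ 1 / 10)
    (hm : Multipliable fun n : ℕ ↦ 1 - q ^ (n + 1)) :
    ‖∏' n : ℕ, (1 - q ^ (n + 1))‖ ≤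
      (1 + ‖q‖) ^ 2 * (1 - ‖q‖) * Real.exp (‖q‖ ^ 3 / (1 - ‖q‖)) := by
  have hr0 : 0 ≤ ‖q‖ := norm_nonneg q
  have ht := ((Filter.tendsto_add_atTop_iff_nat 2).mpr hm.hasProd.tendsto_prod_nat).norm
  refine le_of_tendsto' ht fun n ↦ ?_
  rw [Finset.prod_range_succ', Finset.prod_range_succ', norm_mul, norm_mul]
  have h1 : ‖∏ k ∈ Finset.range n, (1 - q ^ (k + 1 + 1 + 1))‖ ≤ Real.exp (‖q‖ ^ 3 / (1 - ‖q‖)) := by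
    rw [norm_prod]
    calc ∏ k ∈ Finset.range n, ‖1 - q ^ (k + 1 + 1 + 1)‖
        ≤ ∏ k ∈ Finset.range n, Real.exp (‖q‖ ^ 3 * ‖q‖ ^ k) := by
          refine Finset.prod_le_prod (fun _ _ ↦ norm_nonneg _) fun k _ ↦ ?_
          refine (norm_sub_le _ _).trans ?_
          rw [norm_one, norm_pow, add_comm]
          refine le_trans (le_of_eq ?_) (Real.add_one_le_exp _)
          ring
      _ = Real.exp (‖q‖ ^ 3 * ∑ k ∈ Finset.range n, ‖q‖ ^ k) := by
          rw [← Real.exp_sum, Finset.mul_sum]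
      _ ≤ _ := by
          rw [div_eq_mul_inv]
          gcongr
          exact (summable_geometric_of_lt_one hr0 (by linarith)).sum_le_tsum _
            (fun _ _ ↦ by positivity) |>.trans_eq (tsum_geometric_of_lt_one hr0 (by linarith))
  have h2 := norm_one_sub_mul_norm_one_sub_sq_le hq
  calc _ = ‖1 - q‖ * ‖1 - q ^ 2‖ * ‖∏ k ∈ Finset.range n, (1 - q ^ (k + 1 + 1 + 1))‖ := by
        simp; ring
    _ ≤ _ := by
        refine mul_le_mul h2 h1 (norm_nonneg _) ?_
        exact mul_nonneg (by positivity) (by linarith)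

/-- The logarithm of the polynomial is `r - 3/2 r² + ⋯`. Weakening `3/2` to `1.41` absorbs its
higher terms, and then to `7/5` absorbs the tail. -/
theorem one_add_sq_mul_one_sub_mul_exp_le {r : ℝ} (h0 : 0 ≤ r) (h1 : r ≤ 1 / 200) :
    (1 + r) ^ 2 * (1 - r) * Real.exp (r ^ 3 / (1 - r)) ≤ Real.exp (r - 7 / 5 * r ^ 2) := by
  have hs : r ^ 3 / (1 - r) ≤ 1 / 100 * r ^ 2 := by
    rw [div_le_iff₀ (by linarith)]
    nlinarith [sq_nonneg r]
  have hu : 0 ≤ r - 141 / 100 * r ^ 2 := by nlinarith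
  have h2 : (1 + r) ^ 2 * (1 - r) ≤ Real.exp (r - 141 / 100 * r ^ 2) := by
    refine le_trans ?_ (Real.quadratic_le_exp_of_nonneg hu)
    have h3 : r ^ 3 ≤ 1 / 200 * r ^ 2 := by nlinarith [sq_nonneg r]
    have h4 : 0 ≤ r ^ 4 := by positivity
    nlinarith
  calc _ ≤ Real.exp (r - 141 / 100 * r ^ 2) * Real.exp (1 / 100 * r ^ 2) := by gcongr
    _ = _ := by rw [← Real.exp_add]; ring_nf

theorem norm_eta_le (τ : ℍ) (h : Real.exp (-(2 * π * τ.im)) ≤ 1 / 200) :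
    ‖eta τ‖ ≤ Real.exp (-(π * τ.im / 12) + (Real.exp (-(2 * π * τ.im))
      - 7 / 5 * Real.exp (-(2 * π * τ.im)) ^ 2)) := by
  have hn : ‖Function.Periodic.qParam 1 (τ : ℂ)‖ = Real.exp (-(2 * π * τ.im)) := by
    simp [Function.Periodic.norm_qParam]
  have hn24 : ‖Function.Periodic.qParam 24 (τ : ℂ)‖ = Real.exp (-(π * τ.im / 12)) := by
    simp [Function.Periodic.norm_qParam]
    ring
  have hm := multipliableLocallyUniformlyOn_eta.multipliable τ.2
  have h1 := norm_tprod_one_sub_pow_le (q := Function.Periodic.qParam 1 (τ : ℂ))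
    (by rw [hn]; linarith) hm
  rw [hn] at h1
  have h2 := one_add_sq_mul_one_sub_mul_exp_le (Real.exp_pos _).le h
  rw [eta, norm_mul, hn24, Real.exp_add]
  gcongr
  exact h1.trans h2

/-! ### Monotonicity in `Im τ` and numerical evaluation -/

theorem exp_pi_sqrt_three_bounds :
    40377 / 100000 ≤ Real.exp (-(π * √3 / 6)) ∧
      Real.exp (-(π * √3 / 6)) ≤ 403775 / 1000000 := by
  have hs1 : (1.7320508 : ℝ) ≤ √3 := Real.le_sqrt_of_sq_le (by norm_num)
  have hs2 : √3 ≤ 1.7320509 := Real.sqrt_le_iff.mpr (by norm_num)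
  have hp1 := Real.pi_gt_d6
  have hp2 := Real.pi_lt_d6
  have hx1 : (0.9068994 : ℝ) ≤ π * √3 / 6 := by nlinarith
  have hx2 : π * √3 / 6 ≤ 0.9069 := by nlinarith
  constructor
  · rw [Real.exp_neg, ← one_div, le_div_iff₀ (Real.exp_pos _)]
    have := Real.exp_bound' (x := 0.9069) (by norm_num) (by norm_num) (n := 9) (by norm_num)
    have h2 : Real.exp (π * √3 / 6) ≤ Real.exp (9069 / 10000) :=
      Real.exp_le_exp.mpr (hx2.trans (by norm_num))
    norm_num [Finset.sum_range_succ, Nat.factorial] at this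
    linarith
  · rw [Real.exp_neg, inv_le_comm₀ (Real.exp_pos _) (by norm_num)]
    have := Real.sum_le_exp_of_nonneg (x := 0.9068994) (by norm_num) 11
    have h2 : Real.exp (4534497 / 5000000) ≤ Real.exp (π * √3 / 6) :=
      Real.exp_le_exp.mpr (le_trans (by norm_num) hx1)
    norm_num [Finset.sum_range_succ, Nat.factorial] at this ⊢
    linarith

theorem exp_two_pi_mul_sqrt_three_half_bounds :
    433315 / 100000000 ≤ Real.exp (-(2 * π * (√3 / 2))) ∧
      Real.exp (-(2 * π * (√3 / 2))) ≤ 433350 / 100000000 := by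
  have : Real.exp (-(2 * π * (√3 / 2))) = Real.exp (-(π * √3 / 6)) ^ 6 := by
    rw [← Real.exp_nat_mul]; congr 1; push_cast; ring
  obtain ⟨h1, h2⟩ := exp_pi_sqrt_three_bounds
  rw [this]
  constructor
  · refine le_trans ?_ (pow_le_pow_left₀ (by norm_num) h1 6)
    norm_num
  · refine le_trans (pow_le_pow_left₀ (Real.exp_pos _).le h2 6) ?_
    norm_num

/-- This is the derivative sign needed for `antitoneOn_log_sub_add_exp`. It is tight at `y = √3/2`,
with slack about `10⁻⁴`, so the numerical bounds must be fine. -/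
theorem one_div_sub_pi_div_three_le {y : ℝ} (hy : √3 / 2 ≤ y) :
    1 / y - π / 3 ≤ 8 * π * (Real.exp (-(2 * π * y))
      - 14 / 5 * Real.exp (-(2 * π * y)) ^ 2) := by
  have hs1 : (1.7320508 : ℝ) ≤ √3 := Real.le_sqrt_of_sq_le (by norm_num)
  have hs2 : √3 ≤ 1.7320509 := Real.sqrt_le_iff.mpr (by norm_num)
  have hp1 := Real.pi_gt_d6
  have hp2 := Real.pi_lt_d6
  obtain ⟨hr1, hr2⟩ := exp_two_pi_mul_sqrt_three_half_bounds
  have hy0 : 0 < y := by linarith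
  set t := y - √3 / 2 with ht
  have ht0 : 0 ≤ t := by linarith
  set r := Real.exp (-(2 * π * y)) with hr
  have hr0 : 0 < r := Real.exp_pos _
  have hrr : r = Real.exp (-(2 * π * (√3 / 2))) * Real.exp (-(2 * π * t)) := by
    rw [hr, ← Real.exp_add]; congr 1; rw [ht]; ring
  have hrle : r ≤ 433350 / 100000000 := by
    rw [hrr]
    refine le_trans (mul_le_of_le_one_right (Real.exp_pos _).le ?_) hr2
    exact Real.exp_le_one_iff.mpr (by simp only [Left.neg_nonpos_iff]; positivity)
  have hrhs : 8 * π * (r * (1 - 14 / 5 * (433350 / 100000000))) ≤ 8 * π * (r - 14 / 5 * r ^ 2) := by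
    gcongr
    nlinarith
  refine le_trans ?_ hrhs
  rcases le_or_gt (1 / y) (π / 3) with h | h
  · refine le_trans (sub_nonpos.mpr h) ?_
    exact mul_nonneg (by positivity) (mul_nonneg hr0.le (by norm_num))
  · have hyu : y < 0.955 := by
      rw [lt_div_iff₀ hy0] at h
      nlinarith
    have hrge : 433315 / 100000000 * (1 - 2 * π * t) ≤ r := by
      have h1 : 1 - 2 * π * t ≤ Real.exp (-(2 * π * t)) := by
        linarith [Real.add_one_le_exp (-(2 * π * t))]
      have h3 : 0 ≤ 1 - 2 * π * t := by nlinarith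
      rw [hrr]
      gcongr
    -- `1.154701` is `2/√3` rounded up. Slope `-1` suffices: the linear lower bound for the right
    -- side falls more slowly.
    have hinv : 1 / y ≤ 1.154701 - t := by
      rw [div_le_iff₀ hy0]
      have : y = √3 / 2 + t := by rw [ht]; ring
      rw [this]
      nlinarith
    have h5 : 8 * 3.141592 * (433315 / 100000000 * (1 - 2 * π * t) *
        (1 - 14 / 5 * (433350 / 100000000))) ≤
        8 * π * (r * (1 - 14 / 5 * (433350 / 100000000))) := by
      gcongr
      nlinarith
    refine le_trans ?_ h5
    have h6 : π * t ≤ 3.141593 * t := by gcongr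
    linarith

theorem antitoneOn_log_sub_add_exp :
    AntitoneOn (fun y : ℝ ↦ Real.log y - π * y / 3 + 4 * (Real.exp (-(2 * π * y))
      - 7 / 5 * Real.exp (-(2 * π * y)) ^ 2)) (Set.Ici (√3 / 2)) := by
  have hs : 0 < √3 / 2 := by positivity
  have hd : ∀ y : ℝ, √3 / 2 ≤ y → HasDerivAt (fun y : ℝ ↦ Real.log y - π * y / 3 +
      4 * (Real.exp (-(2 * π * y)) - 7 / 5 * Real.exp (-(2 * π * y)) ^ 2))
      (1 / y - π / 3 - 8 * π * (Real.exp (-(2 * π * y))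
        - 14 / 5 * Real.exp (-(2 * π * y)) ^ 2)) y := by
    intro y hy
    have h1 := Real.hasDerivAt_log (hs.trans_le hy).ne'
    have h2 : HasDerivAt (fun y : ℝ ↦ π * y / 3) (π / 3) y := by
      simpa using ((hasDerivAt_id y).const_mul π).div_const 3
    have h3 : HasDerivAt (fun y : ℝ ↦ Real.exp (-(2 * π * y)))
        (Real.exp (-(2 * π * y)) * -(2 * π)) y := by
      have : HasDerivAt (fun y : ℝ ↦ -(2 * π * y)) (-(2 * π)) y := by
        simpa using! ((hasDerivAt_id y).const_mul (2 * π)).neg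
      exact this.exp
    convert! (h1.sub h2).add ((h3.sub ((h3.pow 2).const_mul (7 / 5))).const_mul 4) using 1
    ring
  refine antitoneOn_of_deriv_nonpos (convex_Ici _)
    (fun y hy ↦ (hd y hy).continuousAt.continuousWithinAt)
    (fun y hy ↦ (hd y (interior_subset hy)).differentiableAt.differentiableWithinAt) fun y hy ↦ ?_
  rw [(hd y (interior_subset hy)).deriv]
  exact sub_nonpos.mpr (one_div_sub_pi_div_three_le (interior_subset hy))

theorem four_pi_sq_mul_bound_at_sqrt_three_half :
    4 * π ^ 2 * (√3 / 2 * Real.exp (-(π * (√3 / 2) / 3) + 4 * (Real.exp (-(2 * π * (√3 / 2)))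
      - 7 / 5 * Real.exp (-(2 * π * (√3 / 2))) ^ 2))) ≤ 14.045 := by
  have hs2 : √3 ≤ 1.7320509 := Real.sqrt_le_iff.mpr (by norm_num)
  have hp2 := Real.pi_lt_d6
  obtain ⟨hr1, hr2⟩ := exp_two_pi_mul_sqrt_three_half_bounds
  obtain ⟨-, hE⟩ := exp_pi_sqrt_three_bounds
  set r := Real.exp (-(2 * π * (√3 / 2)))
  have hx : 4 * (r - 7 / 5 * r ^ 2) ≤ 0.0172293 := by nlinarith
  have h1 : Real.exp (4 * (r - 7 / 5 * r ^ 2)) ≤ 1.0173787 := by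
    refine (Real.exp_le_exp.mpr hx).trans ?_
    have := Real.exp_bound' (x := 0.0172293) (by norm_num) (by norm_num) (n := 4) (by norm_num)
    refine this.trans ?_
    norm_num [Finset.sum_range_succ, Nat.factorial]
  rw [Real.exp_add, show π * (√3 / 2) / 3 = π * √3 / 6 by ring]
  calc _ ≤ (4 : ℝ) * 3.141593 ^ 2 * (1.7320509 / 2 * (403775 / 1000000 * 1.0173787)) := by gcongr
    _ ≤ _ := by norm_num

theorem four_pi_sq_mul_im_mul_norm_eta_pow_le {τ : ℍ} (h : √3 / 2 ≤ τ.im) :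
    4 * π ^ 2 * (τ.im * ‖eta τ‖ ^ 4) ≤ 14.045 := by
  have hs : 0 < √3 / 2 := by positivity
  have hanti := antitoneOn_log_sub_add_exp (Set.mem_Ici.mpr le_rfl) (Set.mem_Ici.mpr h) h
  have hr : Real.exp (-(2 * π * τ.im)) ≤ 1 / 200 := by
    refine le_trans (Real.exp_le_exp.mpr ?_)
      (exp_two_pi_mul_sqrt_three_half_bounds.2.trans (by norm_num))
    gcongr
  have heta := norm_eta_le τ hr
  refine le_trans ?_ four_pi_sq_mul_bound_at_sqrt_three_half
  gcongr 4 * π ^ 2 * ?_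
  have h4 : ‖eta τ‖ ^ 4 ≤ Real.exp (-(π * τ.im / 3) + 4 * (Real.exp (-(2 * π * τ.im))
      - 7 / 5 * Real.exp (-(2 * π * τ.im)) ^ 2)) := by
    refine (pow_le_pow_left₀ (norm_nonneg _) heta 4).trans_eq ?_
    rw [← Real.exp_nat_mul]
    congr 1
    push_cast
    ring
  refine (mul_le_mul_of_nonneg_left h4 τ.im_pos.le).trans ?_
  have hexp : ∀ {x : ℝ} (_ : 0 < x) (u : ℝ), x * Real.exp u = Real.exp (Real.log x + u) :=
    fun hx u ↦ by rw [Real.exp_add, Real.exp_log hx]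
  rw [hexp τ.im_pos, hexp hs]
  refine Real.exp_le_exp.mpr ?_
  linarith

/-! ### Modular invariance and the fundamental domain -/

/-- The square of this quantity is the norm of the invariant Petersson product of the discriminant
form with itself. -/
theorem norm_discriminant_mul_im_pow_smul (g : SL(2, ℤ)) (τ : ℍ) :
    ‖discriminant (g • τ)‖ * (g • τ).im ^ 6 = ‖discriminant τ‖ * τ.im ^ 6 := by
  have h : ‖petersson 12 CuspForm.discriminant CuspForm.discriminant (g • τ)‖ =
      ‖petersson 12 CuspForm.discriminant CuspForm.discriminant τ‖ := by
    rw [← petersson_slash_SL]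
    congr 2 <;> exact SlashInvariantFormClass.slash_action_eq CuspForm.discriminant _
      (MonoidHom.mem_range.mpr ⟨g, rfl⟩)
  have h2 : ∀ τ : ℍ, ‖petersson 12 CuspForm.discriminant CuspForm.discriminant τ‖ =
      (‖discriminant τ‖ * τ.im ^ 6) ^ 2 := by
    intro τ
    have : ‖(τ.im : ℂ) ^ (12 : ℤ)‖ = τ.im ^ 12 := by
      rw [norm_zpow, Complex.norm_of_nonneg τ.im_pos.le]; norm_cast
    rw [petersson, norm_mul, norm_mul, RCLike.norm_conj, this, CuspForm.coe_discriminant]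
    ring
  rw [h2, h2] at h
  exact (pow_left_inj₀ (mul_nonneg (norm_nonneg _) (pow_nonneg (g • τ).im_pos.le _))
    (mul_nonneg (norm_nonneg _) (pow_nonneg τ.im_pos.le _)) two_ne_zero).mp h

/-- The maximum of `|Δ(τ)| Im(τ)⁶` is attained at `τ = exp(2πi/3)`; this bound is sharp to five
significant digits. -/
theorem norm_discriminant_mul_im_pow_le (τ : ℍ) :
    (2 * π) ^ 12 * (‖discriminant τ‖ * τ.im ^ 6) ≤ 14.045 ^ 6 := by
  obtain ⟨g, hg⟩ := ModularGroup.exists_smul_mem_fd τ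
  rw [← norm_discriminant_mul_im_pow_smul g τ]
  have h3 := ModularGroup.three_le_four_mul_im_sq_of_mem_fd hg
  have hy : √3 / 2 ≤ (g • τ).im := by
    have : √3 ≤ 2 * (g • τ).im :=
      Real.sqrt_le_iff.mpr ⟨by linarith [(g • τ).im_pos], by linarith⟩
    linarith
  have h := four_pi_sq_mul_im_mul_norm_eta_pow_le hy
  have hp := (g • τ).im_pos
  refine le_trans (le_of_eq ?_) (pow_le_pow_left₀ (by positivity) h 6)
  rw [discriminant, norm_pow]
  ring

/-! ### Existence of the period lattice -/

theorem ModularFormClass.tendsto_valueAtInfty {k : ℤ} (f : ModularForm 𝒮ℒ k) :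
    Tendsto f atImInfty (𝓝 (valueAtInfty f)) := by
  obtain ⟨c, hc, h⟩ := exp_decay_sub_atImInfty' f
  have h0 : Tendsto (fun τ : ℍ ↦ Real.exp (-c * τ.im)) atImInfty (𝓝 0) :=
    Real.tendsto_exp_atBot.comp
      ((tendsto_const_mul_atBot_of_neg (by linarith)).mpr tendsto_comap)
  exact tendsto_sub_nhds_zero_iff.mp (h.trans_tendsto h0)

theorem EisensteinSeries.tendsto_E {k : ℕ} (hk : 3 ≤ k) (hk2 : Even k) :
    Tendsto (E hk) atImInfty (𝓝 1) := by
  have h := ModularFormClass.tendsto_valueAtInfty (E hk)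
  have h1 := E_qExpansion_coeff_zero hk hk2
  rw [qExpansion_coeff_zero one_pos
    (ModularFormClass.analyticAt_cuspFunction_zero _ one_pos one_mem_strictPeriods_SL)
    (SlashInvariantFormClass.periodic_comp_ofComplex _ one_mem_strictPeriods_SL)] at h1
  rwa [h1] at h

/-- A level one modular form of positive weight that does not vanish at the cusp has a zero in the
upper half plane: otherwise its inverse would be a modular form of negative weight. -/
theorem ModularForm.exists_eq_zero_of_tendsto {k : ℤ} (hk : 0 < k) (f : ModularForm 𝒮ℒ k) {c : ℂ}
    (hc : c ≠ 0) (hf : Tendsto f atImInfty (𝓝 c)) : ∃ τ : ℍ, f τ = 0 := by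
  by_contra! h0
  have hslash (γ : SL(2, ℤ)) :
      ((1 : ModularForm 𝒮ℒ 0) / f : ℍ → ℂ) ∣[0 - k] γ = ((1 : ModularForm 𝒮ℒ 0) / f : ℍ → ℂ) := by
    have hγ : (γ : GL (Fin 2) ℝ) ∈ 𝒮ℒ := ⟨γ, rfl⟩
    simp_rw [div_slash_SL2, SL_slash, SlashInvariantForm.slash_action_eqn _ _ hγ]
  let g : ModularForm 𝒮ℒ (0 - k) :=
    { toFun := ((1 : ModularForm 𝒮ℒ 0) / f : ℍ → ℂ)
      slash_action_eq' := fun _ ⟨γ, hγ⟩ ↦ hγ ▸ hslash γ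
      holo' := (1 : ModularForm 𝒮ℒ 0).holo'.div f.holo' h0
      bdd_at_cusps' {c} hc := by
        rw [Subgroup.IsArithmetic.isCusp_iff_isCusp_SL2Z] at hc
        rw [OnePoint.isBoundedAt_iff_forall_SL2Z hc]
        intro γ _
        rw [hslash γ]
        exact ((tendsto_const_nhds (x := (1 : ℂ))).div hf ‹_›).isBigO_one ℝ }
  have hg := ModularFormClass.levelOne_neg_weight_eq_zero (by omega) g
  have := congrFun hg I
  have h2 : g I = 1 / f I := rfl
  rw [h2] at this
  simp [h0 I] at this

/-- The pairs `(c₄, c₆)` with `c₄³ ≠ c₆²` are, up to scaling, values of `(E₄, E₆)`. -/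
theorem exists_E₄_E₆_eq {a b : ℂ} (h : a ^ 3 ≠ b ^ 2) :
    ∃ (τ : ℍ) (u : ℂ), u ≠ 0 ∧ a = u ^ 4 * E₄ τ ∧ b = u ^ 6 * E₆ τ := by
  let F : ModularForm 𝒮ℒ 12 := b ^ 2 • ModularForm.mcast (by decide) (E₄.pow 3) -
    a ^ 3 • ModularForm.mcast (by decide) (E₆.pow 2)
  have hF (τ : ℍ) : F τ = b ^ 2 * E₄ τ ^ 3 - a ^ 3 * E₆ τ ^ 2 := by
    simp only [F, coe_mcast, coe_pow, sub_apply, smul_apply, Pi.pow_apply, smul_eq_mul]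
  have hlim : Tendsto F atImInfty (𝓝 (b ^ 2 * 1 ^ 3 - a ^ 3 * 1 ^ 2)) := by
    simp_rw [funext hF]
    exact (((tendsto_E _ ⟨2, rfl⟩).pow 3).const_mul _).sub
      (((tendsto_E _ ⟨3, rfl⟩).pow 2).const_mul _)
  obtain ⟨τ, hτ⟩ := ModularForm.exists_eq_zero_of_tendsto (by norm_num) F
    (by simpa [sub_eq_zero] using h.symm) hlim
  rw [hF] at hτ
  have hΔ := discriminant_ne_zero τ
  rw [discriminant_eq_E₄_cube_sub_E₆_sq] at hΔ
  refine ⟨τ, ?_⟩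
  generalize E₄ τ = x at *
  generalize E₆ τ = y at *
  have hxy : x ^ 3 ≠ y ^ 2 := by rintro h; simp [h] at hΔ
  by_cases ha : a = 0
  · subst ha
    have hb : b ≠ 0 := by rintro rfl; simp at h
    have hx : x = 0 := by simpa [hb] using hτ
    subst hx
    have hy : y ≠ 0 := by rintro rfl; simp at hxy
    obtain ⟨u, hu⟩ := IsAlgClosed.exists_pow_nat_eq (b / y) (n := 6) (by norm_num)
    refine ⟨u, ?_, by simp, by rw [hu]; field_simp⟩
    rintro rfl
    simp [hy, hb, eq_comm] at hu
  by_cases hb : b = 0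
  · subst hb
    have hy : y = 0 := by simpa [ha] using hτ
    subst hy
    have hx : x ≠ 0 := by rintro rfl; simp at hxy
    obtain ⟨u, hu⟩ := IsAlgClosed.exists_pow_nat_eq (a / x) (n := 4) (by norm_num)
    refine ⟨u, ?_, by rw [hu]; field_simp, by simp⟩
    rintro rfl
    simp [hx, ha, eq_comm] at hu
  have hx : x ≠ 0 := by
    rintro rfl
    have hy : y = 0 := by simpa [ha] using hτ
    simp [hy] at hxy
  have hy : y ≠ 0 := by
    rintro rfl
    simp [hb, hx] at hτ
  -- Dividing `b = u⁶ y` by `a = u⁴ x` forces `u²`.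
  obtain ⟨u, hu⟩ := IsAlgClosed.exists_pow_nat_eq (b * x / (y * a)) (n := 2) (by norm_num)
  refine ⟨u, ?_, ?_, ?_⟩
  · rintro rfl
    simp [hx, hy, ha, hb, eq_comm] at hu
  · rw [show u ^ 4 = (u ^ 2) ^ 2 by ring, hu]
    field_simp
    linear_combination -hτ
  · rw [show u ^ 6 = (u ^ 2) ^ 3 by ring, hu]
    field_simp
    linear_combination -hτ

theorem WeierstrassCurve.exists_isPeriodPair (W : WeierstrassCurve ℂ) (hΔ : W.Δ ≠ 0) :
    ∃ L : PeriodPair, W.IsPeriodPair L := by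
  have h : W.c₄ ^ 3 ≠ W.c₆ ^ 2 := by
    intro h
    have := W.c_relation
    rw [h, sub_self] at this
    simp [hΔ] at this
  obtain ⟨τ, u, hu, h4, h6⟩ := exists_E₄_E₆_eq h
  have hπ : (π : ℂ) ≠ 0 := by exact_mod_cast Real.pi_ne_zero
  -- With `ω₁ = 2π/u`, `g₂ = 4/3 (u/2)⁴ E₄ = u⁴ E₄ / 12`.
  have hω : 2 * π / u ≠ 0 := by simp [hu, hπ]
  refine ⟨PeriodPair.ofUpperHalfPlane (2 * π / u) hω τ, ?_⟩
  rw [W.isPeriodPair_iff, PeriodPair.g₂_eq_E₄ _ τ rfl, PeriodPair.g₃_eq_E₆ _ τ rfl, h4, h6]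
  simp only [PeriodPair.ofUpperHalfPlane]
  constructor
  · field_simp
    ring
  · field_simp
    ring

/-! ### The inequality for the covolume -/

theorem WeierstrassCurve.norm_Δ_mul_parallelogramArea_pow_le {W : WeierstrassCurve ℂ}
    {L : PeriodPair} (h : W.IsPeriodPair L) :
    ‖W.Δ‖ * L.parallelogramArea ^ 6 ≤ 14.045 ^ 6 := by
  obtain ⟨L', hL, him⟩ := L.exists_lattice_eq_im_pos
  have h1 := L'.ω₁_ne_zero
  have hτ : L'.ω₂ = L'.ω₁ * (⟨L'.ω₂ / L'.ω₁, him⟩ : ℍ) := by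
    change L'.ω₂ = L'.ω₁ * (L'.ω₂ / L'.ω₁)
    field_simp
  have hd := L'.g₂_cube_sub_eq_discriminant _ hτ
  have hg2 : L.g₂ = L'.g₂ := by rw [PeriodPair.g₂, PeriodPair.g₂, PeriodPair.G_congr hL]
  have hg3 : L.g₃ = L'.g₃ := by rw [PeriodPair.g₃, PeriodPair.g₃, PeriodPair.G_congr hL]
  have hn : ‖L'.ω₁‖ ≠ 0 := norm_ne_zero_iff.mpr h1
  rw [PeriodPair.g₂_cube_sub_of_isPeriodPair h, hg2, hg3, hd,
    ← PeriodPair.parallelogramArea_congr hL, L'.parallelogramArea_eq, abs_of_pos him]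
  refine le_trans (le_of_eq ?_)
    (norm_discriminant_mul_im_pow_le (⟨L'.ω₂ / L'.ω₁, him⟩ : ℍ))
  rw [norm_mul, norm_pow, norm_div, norm_mul, Complex.norm_real, Real.norm_of_nonneg Real.pi_pos.le]
  change _ = _ * (_ * (L'.ω₂ / L'.ω₁).im ^ 6)
  simp only [Complex.norm_ofNat]
  field_simp

theorem lemma1 (W : WeierstrassCurve ℝ) [W.IsElliptic] :
    (∃ L : PeriodPair, (W.map (algebraMap ℝ ℂ)).IsPeriodPair L) ∧
    ∀ L : PeriodPair, (W.map (algebraMap ℝ ℂ)).IsPeriodPair L →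
      1 / L.parallelogramArea ≥ |W.Δ| ^ (1 / 6 : ℝ) / 14.045 := by
  have hΔ : (W.map (algebraMap ℝ ℂ)).Δ = (W.Δ : ℂ) := by simp
  have hW : W.Δ ≠ 0 := W.isUnit_Δ.ne_zero
  refine ⟨WeierstrassCurve.exists_isPeriodPair _ (by rw [hΔ]; exact_mod_cast hW), fun L h ↦ ?_⟩
  have hA : 0 < L.parallelogramArea := ZLattice.covolume_pos L.lattice MeasureTheory.volume
  have hb := WeierstrassCurve.norm_Δ_mul_parallelogramArea_pow_le h
  rw [hΔ, Complex.norm_real, Real.norm_eq_abs] at hb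
  have hx : 0 ≤ |W.Δ| ^ (1 / 6 : ℝ) := by positivity
  have hx6 : (|W.Δ| ^ (1 / 6 : ℝ)) ^ 6 = |W.Δ| := by
    rw [← Real.rpow_natCast, ← Real.rpow_mul (abs_nonneg _)]
    norm_num
  rw [← hx6, ← mul_pow] at hb
  have := le_of_pow_le_pow_left₀ (by norm_num) (by norm_num) hb
  rw [ge_iff_le, div_le_div_iff₀ (by norm_num) hA]
  linarith
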